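/- Let $G$ be a finite group acting by ring automorphisms on a commutative ring $R$. For a subgroup $H\le G$ let $R^H$ be the subring of $H$-invariant elements, and let $\operatorname{tr}_{G/H}\colon R^H\to R^G$, $\operatorname{tr}_{G/H}(r)=\sum_{gH\in G/H} g(r)$, be the relative trace map; its image is an ideal of $R^G$. A commutative ring $A$ is called Cohen–Macaulay if it is noetherian and $\operatorname{depth}(\mathfrak a,A)=\operatorname{height}\mathfrak a$ for every ideal $\mathfrak a$ of $A$, where $\operatorname{depth}(\mathfrak a,A)$ is the supremum of the lengths of $A$-regular sequences contained in $\mathfrak a$ (and depth and height of the unit ideal are $\infty$). Let $\mathcal{CM}$ be the set of subgroups $H$ of $G$ such that $R^H$ is Cohen–Macaulay. Then for every prime ideal $\mathfrak q$ of $R^G$ with $\mathfrak q\not\supseteq\sum_{H\in\mathcal{CM}}\operatorname{im}\operatorname{tr}_{G/H}$, the localization $(R^G)_{\mathfrak q}$ is Cohen–Macaulay. In particular, if $\mathcal X$ is a set of subgroups of $G$ such that $R^H$ is Cohen–Macaulay for every $H\in\mathcal X$ and the indices $[G:H]$, $H\in\mathcal X$, generate the unit ideal of $R^G$, then $R^G$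 is Cohen–Macaulay. -/

import Mathlib

/-- The depth `depth(𝔞, A)` of an ideal `𝔞` of a commutative ring `A`: the supremum of the lengths
of the `A`-regular sequences contained in `𝔞`. If `𝔞 ≠ A`, then a weakly regular sequence in `𝔞`
is automatically regular; if `𝔞 = A`, then the sequences `1, …, 1` make the supremum `∞`, which is
the usual convention. -/
noncomputable def idealDepth {A : Type*} [CommRing A] (𝔞 : Ideal A) : ℕ∞ :=
  ⨆ (rs : List A) (_ : ∀ r ∈ rs, r ∈ 𝔞) (_ : RingTheory.Sequence.IsWeaklyRegular A rs),
    (rs.length : ℕ∞)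

/-- A commutative ring is Cohen-Macaulay if it is noetherian and `depth(𝔞, A) = height 𝔞` for all
ideals `𝔞` (the unit ideal has depth and height `∞`). -/
structure IsCohenMacaulayRing (A : Type*) [CommRing A] : Prop where
  isNoetherianRing : IsNoetherianRing A
  depth_eq_height : ∀ 𝔞 : Ideal A, idealDepth 𝔞 = 𝔞.height

section Invariants

variable (R : Type*) [CommRing R] {G : Type*} [Group G] [MulSemiringAction G R]

/-- The subring `R^H` of invariants of a subgroup `H` of `G`. -/
def invariantSubring (H : Subgroup G) : Subring R where
  carrier := {r | ∀ h ∈ H, h • r = r}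
  mul_mem' ha hb h hh := by rw [smul_mul', ha h hh, hb h hh]
  one_mem' _ _ := smul_one _
  add_mem' ha hb h hh := by rw [smul_add, ha h hh, hb h hh]
  zero_mem' _ _ := smul_zero _
  neg_mem' ha h hh := by rw [smul_neg, ha h hh]

variable {R}

/-- For an `H`-invariant element `r`, the element `g • r` depends only on the coset `gH`. -/
def cosetSMul (H : Subgroup G) (r : invariantSubring R H) : G ⧸ H → R :=
  Quotient.lift (fun g : G => g • (r : R)) (by
    intro a b hab
    have h := r.2 _ (QuotientGroup.leftRel_apply.mp hab)
    rw [mul_smul, inv_smul_eq_iff] at h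
    exact h.symm)

theorem cosetSMul_mk (H : Subgroup G) (r : invariantSubring R H) (g : G) :
    cosetSMul H r (QuotientGroup.mk g) = g • (r : R) := rfl

theorem smul_cosetSMul (H : Subgroup G) (r : invariantSubring R H) (g : G) (x : G ⧸ H) :
    g • cosetSMul H r x = cosetSMul H r (g • x) := by
  induction x using QuotientGroup.induction_on with
  | H a => exact (mul_smul g a (r : R)).symm

theorem cosetSMul_add (H : Subgroup G) (r s : invariantSubring R H) (x : G ⧸ H) :
    cosetSMul H (r + s) x = cosetSMul H r x + cosetSMul H s x := by
  induction x using QuotientGroup.induction_on with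
  | H a => exact smul_add a (r : R) (s : R)

theorem cosetSMul_zero (H : Subgroup G) (x : G ⧸ H) :
    cosetSMul H (0 : invariantSubring R H) x = 0 := by
  induction x using QuotientGroup.induction_on with
  | H a => exact smul_zero a

/-- The relative trace map `tr_{G/H} : R^H → R^G`, `r ↦ ∑_{gH ∈ G/H} g(r)`. Here `R^G` is the
subring of invariants of the whole group `⊤ : Subgroup G`. -/
noncomputable def relTrace [Finite G] (H : Subgroup G) :
    invariantSubring R H →+ invariantSubring R (⊤ : Subgroup G) :=
  letI : Fintype (G ⧸ H) := Fintype.ofFinite _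
  { toFun := fun r => ⟨∑ x : G ⧸ H, cosetSMul H r x, fun g _ => by
      rw [Finset.smul_sum]
      simp only [smul_cosetSMul]
      exact Equiv.sum_comp (MulAction.toPerm g) (cosetSMul H r)⟩
    map_zero' := Subtype.ext (Finset.sum_eq_zero fun x _ => cosetSMul_zero H x)
    map_add' := fun r s => Subtype.ext (by
      simp only [cosetSMul_add, Finset.sum_add_distrib, Subring.coe_add]) }

/-- The image of the relative trace map, as an ideal of `R^G`. -/
noncomputable def relTraceIdeal [Finite G] (H : Subgroup G) :
    Ideal (invariantSubring R (⊤ : Subgroup G)) where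
  __ := (relTrace (R := R) H).range
  smul_mem' := by
    rintro c _ ⟨r, rfl⟩
    refine ⟨⟨(c : R) * r, fun h hh => ?_⟩, Subtype.ext ?_⟩
    · rw [smul_mul', c.2 h trivial, r.2 h hh]
    · simp only [relTrace, AddMonoidHom.coe_mk, ZeroHom.coe_mk, smul_eq_mul, Subring.coe_mul,
        Finset.mul_sum]
      refine Finset.sum_congr rfl fun x _ => ?_
      induction x using QuotientGroup.induction_on with
      | H a => simp only [cosetSMul_mk, smul_mul', c.2 a trivial]

variable (R) in
/-- The ideal `∑_{H ∈ 𝒳} im tr_{G/H}` of `R^G`, for a collection `𝒳` of subgroups of `G`. -/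
noncomputable def traceIdealOf [Finite G] (𝒳 : Set (Subgroup G)) :
    Ideal (invariantSubring R (⊤ : Subgroup G)) :=
  ⨆ H ∈ 𝒳, relTraceIdeal H

variable (G) in
/-- The set of subgroups `H` of `G` such that `R^H` is Cohen-Macaulay. -/
def cohenMacaulaySubgroups (R : Type*) [CommRing R] [MulSemiringAction G R] :
    Set (Subgroup G) :=
  {H | IsCohenMacaulayRing (invariantSubring R H)}

end Invariants

/-!
Write `A = R^G`. The proof of both statements is a descent along the algebras `B = R^H`, with `H`
running through a finite set `𝒳` of subgroups for which `R^H` is Cohen-Macaulay.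

Suppose that `u = ∑ tr_{G/H}(r_H)` lies in a submonoid `S` of `A`. The maps `b ↦ tr_{G/H}(b r_H)`
are `A`-linear, and applied to the images of `a ∈ A` they add up to `u a`; so if `a` lies in every
extension `I R^H` of an ideal `I` of `A`, then `u a ∈ I` (`sum_apply_one_mul_mem`). After inverting
`S`, extended ideals thus contract to themselves. Hence `S⁻¹A` is noetherian, and a sequence in `A`
that is regular on every `R^H` is regular on `S⁻¹A`. No finiteness of `A` itself is needed.

It remains to find in an ideal `𝔟` of `A` sequences of every length up to `height 𝔟` that are
regular on all the `R^H` (`exists_isWeaklyRegular_map_of_le_height`). If `rs` is such a sequence and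
cannot be prolonged inside `𝔟`, then prime avoidance puts `𝔟` into `P ∩ A` for a prime `P` of some
`R^H` associated to `R^H / (rs)`. The long exact `Ext` sequence and the theorem of Rees show that
`P` contains no regular sequence longer than `rs`, so the height of `P` is at most the length of
`rs` because `R^H` is Cohen-Macaulay (`IsCohenMacaulayRing.height_le_length`). Going down holds for
`A ⊆ R`, as `G` permutes the primes of `R` over a given prime of `A` transitively, and it is
inherited by `A ⊆ R^H` (`hasGoingDown_invariantSubring`); therefore `height 𝔟 ≤ height (P ∩ A) ≤
height P`. The reverse inequality `depth ≤ height` holds in every noetherian ring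
(`idealDepth_le_height`).

For the first statement `S` is the complement of `𝔮`; for the second `S` is trivial, since
`tr_{G/H}(1) = [G:H]`.
-/

universe u

/-! ### Regular sequences: length, associated primes and height -/

open RingTheory.Sequence CategoryTheory Abelian Limits in
/-- If `Ext^j(N, M) = 0` for all `j ≤ n` and `rs` is an `M`-regular sequence of length `n`, then
`Hom(N, M / rs M) = 0`: each element of `rs` shifts the vanishing range down by one. -/
theorem subsingleton_linearMap_quotient_of_subsingleton_ext {B : Type u} [CommRing B]
    (N : ModuleCat.{u} B) (rs : List B) (M : ModuleCat.{u} B) (hrs : IsWeaklyRegular M rs)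
    (hext : ∀ j ≤ rs.length, Subsingleton (Ext N M j)) :
    Subsingleton (N →ₗ[B] (M ⧸ (Ideal.ofList rs • ⊤ : Submodule B M))) := by
  induction rs generalizing M with
  | nil =>
    have : Subsingleton (N ⟶ M) := Ext.addEquiv₀.subsingleton_congr.mp (hext 0 le_rfl)
    have : Subsingleton (N →ₗ[B] M) := ModuleCat.homAddEquiv.symm.subsingleton
    have h0 : (Ideal.ofList ([] : List B) • ⊤ : Submodule B M) = ⊥ := by simp
    exact ((Submodule.quotEquivOfEqBot _ h0).congrRight (R := B) (M := N)).toEquiv.subsingleton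
  | cons x rs ih =>
    rw [isWeaklyRegular_cons_iff] at hrs
    have := ih (ModuleCat.of B (QuotSMulTop x M)) hrs.2 fun j hj => by
      have zero1 := AddCommGrpCat.isZero_of_iff_subsingleton.mpr
        (hext j (hj.trans (Nat.le_succ _)))
      have zero2 := AddCommGrpCat.isZero_of_iff_subsingleton.mpr
        (hext (j + 1) (Nat.succ_le_succ hj))
      exact AddCommGrpCat.subsingleton_of_isZero <| ShortComplex.Exact.isZero_of_both_zeros
        ((Ext.covariant_sequence_exact₃' N hrs.1.smulShortComplex_shortExact) j (j + 1) rfl)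
        (zero1.eq_zero_of_src _) (zero2.eq_zero_of_tgt _)
    exact ((Submodule.quotOfListConsSMulTopEquivQuotSMulTopInner M x rs).congrRight
      (R := B) (M := N)).toEquiv.subsingleton

open RingTheory.Sequence in
/-- In a noetherian ring, a prime associated to a regular sequence `rs` contains no regular sequence
longer than `rs`. -/
theorem length_le_of_isAssociatedPrime {B : Type u} [CommRing B] [IsNoetherianRing B]
    {rs ys : List B} {P : Ideal B} (hrs : IsWeaklyRegular B rs)
    (hP : IsAssociatedPrime P (B ⧸ (Ideal.ofList rs • ⊤ : Submodule B B)))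
    (hys : IsWeaklyRegular B ys) (hmem : ∀ y ∈ ys, y ∈ P) : ys.length ≤ rs.length := by
  by_contra! hlt
  obtain ⟨hprime, f, hf⟩ := (isAssociatedPrime_iff_exists_injective_linearMap _ _).mp hP
  have hle : Ideal.ofList ys ≤ P := Ideal.span_le.mpr hmem
  have hreg : IsRegular B ys := ⟨hys, fun h => hprime.ne_top <| top_le_iff.mp <|
    le_trans (by simpa using h.le) hle⟩
  have hext := ModuleCat.subsingleton_ext_of_exists_isRegular P (ModuleCat.of B (B ⧸ P))
    (by rw [Module.support_eq_zeroLocus, Ideal.annihilator_quotient]) (ModuleCat.of B B)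
    (by simpa using hprime.ne_top.lt_top) ys hmem hreg
  have := subsingleton_linearMap_quotient_of_subsingleton_ext (ModuleCat.of B (B ⧸ P)) rs
    (ModuleCat.of B B) hrs fun j hj => hext j (hj.trans_lt hlt)
  have hf0 : f = 0 := Subsingleton.elim (α := ModuleCat.of B (B ⧸ P) →ₗ[B] _) f 0
  have : Nontrivial (B ⧸ P) := Ideal.Quotient.nontrivial_iff.mpr hprime.ne_top
  exact one_ne_zero (hf (a₁ := (1 : B ⧸ P)) (a₂ := 0) (by simp [hf0]))

open RingTheory.Sequence in
/-- In the localization at `P`, a regular sequence of length `n` lowers the dimension, which is the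
height of `P`, by `n`. -/
theorem length_le_height_of_isWeaklyRegular {A : Type*} [CommRing A] [IsNoetherianRing A]
    {rs : List A} (hrs : IsWeaklyRegular A rs) {P : Ideal A} [P.IsPrime]
    (hmem : ∀ r ∈ rs, r ∈ P) : (rs.length : ℕ∞) ≤ P.height := by
  have hreg := hrs.isRegular_of_isLocalization_of_mem (Localization.AtPrime P) P hmem
  have hdim := ringKrullDim_add_length_eq_ringKrullDim_of_isRegular _ hreg
  have : Nontrivial (Localization.AtPrime P ⧸
      Ideal.ofList (rs.map (algebraMap A (Localization.AtPrime P)))) :=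
    Ideal.Quotient.nontrivial_iff.mpr fun h => hreg.2 (by simp [h])
  rw [IsLocalization.AtPrime.ringKrullDim_eq_height P (Localization.AtPrime P),
    List.length_map] at hdim
  have h0 := ringKrullDim_nonneg_of_nontrivial (R := Localization.AtPrime P ⧸
      Ideal.ofList (rs.map (algebraMap A (Localization.AtPrime P))))
  have : ((rs.length : ℕ∞) : WithBot ℕ∞) ≤ (P.height : WithBot ℕ∞) := by
    rw [← hdim]
    exact le_add_of_nonneg_left h0
  exact_mod_cast this

theorem idealDepth_le_height {A : Type*} [CommRing A] [IsNoetherianRing A] (𝔞 : Ideal A) :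
    idealDepth 𝔞 ≤ 𝔞.height := by
  refine iSup_le fun rs => iSup_le fun hmem => iSup_le fun hrs => ?_
  rw [Ideal.height_eq_inf_minimalPrimes]
  refine le_iInf₂ fun P hP => ?_
  have := hP.isPrime
  exact length_le_height_of_isWeaklyRegular hrs fun r hr => hP.le (hmem r hr)

open RingTheory.Sequence in
/-- Unmixedness: in a Cohen-Macaulay ring, a prime associated to a regular sequence has height at
most the length of the sequence. -/
theorem IsCohenMacaulayRing.height_le_length {B : Type u} [CommRing B]
    (hB : IsCohenMacaulayRing B) {rs : List B} {P : Ideal B} (hrs : IsWeaklyRegular B rs)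
    (hP : IsAssociatedPrime P (B ⧸ (Ideal.ofList rs • ⊤ : Submodule B B))) :
    P.height ≤ rs.length := by
  have := hB.isNoetherianRing
  rw [← hB.depth_eq_height]
  refine iSup_le fun ys => iSup_le fun hmem => iSup_le fun hys => ?_
  exact_mod_cast length_le_of_isAssociatedPrime hrs hP hys hmem

open RingTheory.Sequence in
theorem isWeaklyRegular_self_iff {A : Type*} [CommRing A] (rs : List A) :
    IsWeaklyRegular A rs ↔ ∀ (k : ℕ) (hk : k < rs.length) (x : A),
      rs[k] * x ∈ Ideal.ofList (rs.take k) → x ∈ Ideal.ofList (rs.take k) := by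
  rw [isWeaklyRegular_iff]
  simp only [isSMulRegular_quotient_iff_mem_of_smul_mem, smul_eq_mul, Ideal.mul_top]

/-! ### Going down and heights -/

theorem Ideal.height_under_le_of_hasGoingDown {A B : Type*} [CommRing A] [CommRing B] [Algebra A B]
    [Algebra.HasGoingDown A B] (P : Ideal B) [P.IsPrime] : (P.under A).height ≤ P.height := by
  change (⟨P.under A, inferInstance⟩ : PrimeSpectrum A).asIdeal.height ≤
    (⟨P, inferInstance⟩ : PrimeSpectrum B).asIdeal.height
  rw [PrimeSpectrum.height_eq_orderHeight, PrimeSpectrum.height_eq_orderHeight]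
  refine Order.height_le fun l hl => ?_
  have : P.LiesOver l.last.asIdeal := ⟨by rw [hl]⟩
  obtain ⟨L, hlen, hlast, -⟩ := Ideal.exists_ltSeries_of_hasGoingDown l P
  rw [← hlen]
  exact Order.length_le_height hlast.le

/-- Going down descends along an integral extension: lift the prime to the top ring, go down there,
and contract. -/
theorem Algebra.HasGoingDown.of_isIntegral_top {A B C : Type*} [CommRing A] [CommRing B]
    [CommRing C] [Algebra A B] [Algebra B C] [Algebra A C] [IsScalarTower A B C]
    [FaithfulSMul B C] [Algebra.IsIntegral B C] [Algebra.HasGoingDown A C] :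
    Algebra.HasGoingDown A B where
  exists_ideal_le_liesOver_of_lt {p} _ Q _ hlt := by
    obtain ⟨⟨Q', hQ', hQ'over⟩⟩ := Ideal.nonempty_primesOver (S := C) Q
    have hunder : Q'.under A = Q.under A := by rw [hQ'over.over, Ideal.under_under]
    obtain ⟨P', hP'Q', hP', hP'over⟩ :=
      Algebra.HasGoingDown.exists_ideal_le_liesOver_of_lt Q' (hunder ▸ hlt)
    refine ⟨P'.under B, ?_, inferInstance, ⟨?_⟩⟩
    · rw [hQ'over.over]
      exact Ideal.comap_mono hP'Q'
    · rw [Ideal.under_under, hP'over.over]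

open scoped Pointwise in
/-- Going down for the ring of invariants of a finite group: go up from a prime over the smaller
prime, and move the result to the given prime by the group, which acts transitively on the
fibres. -/
theorem Algebra.IsInvariant.hasGoingDown (A C G : Type*) [CommRing A] [CommRing C] [Algebra A C]
    [Group G] [Finite G] [MulSemiringAction G C] [SMulCommClass G A C] [FaithfulSMul A C]
    [Algebra.IsInvariant A C G] : Algebra.HasGoingDown A C where
  exists_ideal_le_liesOver_of_lt {p} _ Q _ hlt := by
    have := Algebra.IsInvariant.isIntegral A C G
    obtain ⟨⟨p', hp', hp'over⟩⟩ := Ideal.nonempty_primesOver (S := C) p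
    obtain ⟨q', hle, hq', hq'over⟩ := Ideal.exists_ideal_over_prime_of_isIntegral_of_isPrime
      (Q.under A) p' (by rw [← Ideal.under_def, ← hp'over.over]; exact hlt.le)
    obtain ⟨g, rfl⟩ := Algebra.IsInvariant.exists_smul_of_under_eq A C G q' Q hq'over
    exact ⟨g • p', Ideal.pointwise_smul_le_pointwise_smul_iff.mpr hle, hp'.smul g, hp'over.smul g⟩

/-! ### Descent of the Cohen-Macaulay property -/

section Descent

variable {A : Type u} [CommRing A] {ι : Type*} {B : ι → Type u}
  [∀ i, CommRing (B i)] [∀ i, Algebra A (B i)]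

open RingTheory.Sequence in
/-- An ideal `𝔟` of `A` contains sequences of every length up to its height that are regular on
all of the Cohen-Macaulay algebras `B i` at once. Such a sequence can be prolonged unless `𝔟` is
contained in the contraction of a prime associated to it in some `B i`, and then unmixedness and
going down bound the height of `𝔟` by the length reached. -/
theorem exists_isWeaklyRegular_map_of_le_height [Finite ι] [∀ i, Algebra.HasGoingDown A (B i)]
    (hB : ∀ i, IsCohenMacaulayRing (B i)) (𝔟 : Ideal A) (n : ℕ) (hn : n ≤ 𝔟.height) :
    ∃ rs : List A, rs.length = n ∧ (∀ r ∈ rs, r ∈ 𝔟) ∧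
      ∀ i, IsWeaklyRegular (B i) (rs.map (algebraMap A (B i))) := by
  induction n with
  | zero => exact ⟨[], by simp⟩
  | succ n ih =>
    obtain ⟨rs, hlen, hmem, hreg⟩ := ih (le_trans (by exact_mod_cast n.le_succ) hn)
    let Q (i : ι) := B i ⧸ (Ideal.ofList (rs.map (algebraMap A (B i))) • ⊤ : Submodule (B i) (B i))
    -- the contractions of the primes that consist of zero divisors on some `B i / (rs)`
    let s : Set (Ideal A) := ⋃ i, Ideal.under A '' associatedPrimes (B i) (Q i)
    have hs : s.Finite := Set.finite_iUnion fun i =>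
      have := (hB i).isNoetherianRing
      (associatedPrimes.finite (B i) (Q i)).image _
    have hnot : ¬ ∃ p ∈ s, 𝔟 ≤ p := by
      rintro ⟨_, hp, hle⟩
      obtain ⟨i, P, hP, rfl⟩ := Set.mem_iUnion.mp hp
      have := hP.isPrime
      have h1 := (hB i).height_le_length (hreg i) hP
      have h2 := (hn.trans (Ideal.height_mono hle)).trans
        ((Ideal.height_under_le_of_hasGoingDown P).trans h1)
      rw [List.length_map, hlen] at h2
      exact absurd h2 (by exact_mod_cast n.lt_succ_self.not_ge)
    have hprime : ∀ p ∈ s, p ≠ ⊥ → p ≠ ⊥ → (id p).IsPrime := by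
      rintro _ hp - -
      obtain ⟨i, P, hP, rfl⟩ := Set.mem_iUnion.mp hp
      have := hP.isPrime
      exact inferInstanceAs (P.under A).IsPrime
    obtain ⟨x, hx, hxs⟩ := Set.not_subset.mp
      (mt (Ideal.subset_union_prime_finite hs ⊥ ⊥ hprime).mp hnot)
    refine ⟨rs ++ [x], by simp [hlen], ?_, fun i => ?_⟩
    · simp only [List.mem_append, List.mem_singleton]
      rintro r (hr | rfl)
      exacts [hmem r hr, hx]
    · rw [List.map_append, isWeaklyRegular_append_iff]
      refine ⟨hreg i, (isWeaklyRegular_singleton_iff _ _).mpr ?_⟩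
      have := (hB i).isNoetherianRing
      by_contra hx'
      have hx'' : algebraMap A (B i) x ∈ ⋃ P ∈ associatedPrimes (B i) (Q i), (P : Set (B i)) := by
        rw [biUnion_associatedPrimes_eq_compl_regular]
        exact hx'
      obtain ⟨P, hP, hxP⟩ := Set.mem_iUnion₂.mp hx''
      exact hxs (Set.mem_biUnion (Set.mem_iUnion.mpr ⟨i, P, hP, rfl⟩) hxP)

theorem LinearMap.apply_mem_of_mem_map {A B : Type*} [CommRing A] [CommRing B] [Algebra A B]
    (φ : B →ₗ[A] A) {I : Ideal A} {b : B} (hb : b ∈ I.map (algebraMap A B)) : φ b ∈ I := by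
  refine Submodule.span_induction ?_ (by simp) (fun x y _ _ hx hy => ?_) (fun c x _ hx => ?_)
    (p := fun b _ => ∀ c : B, φ (c * b) ∈ I) hb 1 |> (by simpa using ·)
  · rintro _ ⟨a, ha, rfl⟩ c
    rw [mul_comm, ← Algebra.smul_def, map_smul]
    exact I.mul_mem_right _ ha
  · intro c
    rw [mul_add, map_add]
    exact I.add_mem (hx c) (hy c)
  · intro d
    rw [smul_eq_mul, ← mul_assoc]
    exact hx _

variable (φ : ∀ i, B i →ₗ[A] A)

/-- If `u = ∑ φ i 1`, then `u` multiplies the elements of `A` lying in every extension `I (B i)`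
into `I`. -/
theorem sum_apply_one_mul_mem [Fintype ι] {I : Ideal A} {a : A}
    (ha : ∀ i, algebraMap A (B i) a ∈ I.map (algebraMap A (B i))) : (∑ i, φ i 1) * a ∈ I := by
  rw [Finset.sum_mul]
  refine I.sum_mem fun i _ => ?_
  have := (φ i).apply_mem_of_mem_map (ha i)
  rwa [Algebra.algebraMap_eq_smul_one, map_smul, smul_eq_mul, mul_comm] at this

variable [Fintype ι] (S : Submonoid A) (hu : ∑ i, φ i 1 ∈ S) (A' : Type*) [CommRing A']
  [Algebra A A'] [IsLocalization S A']

include hu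

/-- Extending the contraction of an ideal of `A'` to the `B i` is strictly monotone, so the
ascending chain condition passes from the `B i` to `A'`. -/
theorem isNoetherianRing_localization_of_sum_apply_one_mem [∀ i, IsNoetherianRing (B i)] :
    IsNoetherianRing A' := by
  let F (J : Ideal A') (i : ι) : Ideal (B i) := (J.under A).map (algebraMap A (B i))
  have hF : StrictMono F := by
    intro J J' hlt
    refine lt_of_le_not_ge (fun i => Ideal.map_mono (Ideal.comap_mono hlt.le)) fun hle =>
      hlt.not_ge fun x hx => ?_
    obtain ⟨⟨a, s⟩, hs⟩ := IsLocalization.surj S x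
    have ha : a ∈ J'.under A := by
      rw [Ideal.under_def, Ideal.mem_comap, ← hs]
      exact J'.mul_mem_right _ hx
    -- the numerator `a` of `x ∈ J'` lies in all extensions of `J ∩ A`, so `u a ∈ J`
    have h := sum_apply_one_mul_mem φ fun i => hle i (Ideal.mem_map_of_mem _ ha)
    rw [Ideal.under_def, Ideal.mem_comap, map_mul, ← hs, mul_left_comm, ← map_mul] at h
    refine (Ideal.mul_unit_mem_iff_mem J ?_).mp h
    exact IsLocalization.map_units A' (⟨_, S.mul_mem hu s.2⟩ : S)
  have : WellFoundedGT (∀ i, Ideal (B i)) :=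
    inferInstanceAs (WellFoundedLT (∀ i, (Ideal (B i))ᵒᵈ))
  rw [isNoetherianRing_iff, isNoetherian_iff']
  exact hF.wellFoundedGT

open RingTheory.Sequence in
theorem isWeaklyRegular_localization_of_sum_apply_one_mem {rs : List A}
    (hrs : ∀ i, IsWeaklyRegular (B i) (rs.map (algebraMap A (B i)))) :
    IsWeaklyRegular A' (rs.map (algebraMap A A')) := by
  simp only [isWeaklyRegular_self_iff, List.length_map, List.getElem_map, ← List.map_take,
    ← Ideal.map_ofList] at hrs ⊢
  intro k hk x hx
  obtain ⟨a, s, rfl⟩ := IsLocalization.exists_mk'_eq S x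
  rw [IsLocalization.mul_mk'_eq_mk'_of_mul, IsLocalization.mk'_mem_map_algebraMap_iff S] at hx
  obtain ⟨t, ht, hta⟩ := hx
  rw [IsLocalization.mk'_mem_map_algebraMap_iff S]
  refine ⟨_, S.mul_mem hu ht, ?_⟩
  rw [mul_assoc]
  refine sum_apply_one_mul_mem φ fun i => hrs i k hk _ ?_
  rw [← map_mul, mul_left_comm]
  exact Ideal.mem_map_of_mem _ hta

/-- The Cohen-Macaulay property descends to the localization of `A` at any submonoid containing
`∑ φ i 1`: there, `A` becomes a direct summand of the product of the `B i`. -/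
theorem isCohenMacaulayRing_localization_of_sum_apply_one_mem
    [∀ i, Algebra.HasGoingDown A (B i)] (hB : ∀ i, IsCohenMacaulayRing (B i)) :
    IsCohenMacaulayRing A' := by
  have := fun i => (hB i).isNoetherianRing
  have hA' := isNoetherianRing_localization_of_sum_apply_one_mem φ S hu A'
  refine ⟨hA', fun 𝔞 => (idealDepth_le_height 𝔞).antisymm ?_⟩
  refine ENat.forall_natCast_le_iff_le.mp fun n hn => ?_
  rw [← IsLocalization.height_under S] at hn
  obtain ⟨rs, rfl, hmem, hrs⟩ := exists_isWeaklyRegular_map_of_le_height hB (𝔞.under A) n hn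
  refine le_iSup_of_le (rs.map (algebraMap A A')) <| le_iSup_of_le ?_ <| le_iSup_of_le
    (isWeaklyRegular_localization_of_sum_apply_one_mem φ S hu A' hrs) (by simp)
  simpa using hmem

end Descent

/-! ### Rings of invariants -/

section InvariantSubrings

variable {G : Type*} [Group G] {R : Type u} [CommRing R] [MulSemiringAction G R]

/-- `R^H` as an algebra over `R^G`, through the inclusion. -/
instance invariantSubringAlgebra (H : Subgroup G) :
    Algebra (invariantSubring R (⊤ : Subgroup G)) (invariantSubring R H) :=
  (Subring.inclusion (S := invariantSubring R ⊤) (T := invariantSubring R H)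
    fun _ hr h _ => hr h trivial).toAlgebra

instance (H : Subgroup G) :
    IsScalarTower (invariantSubring R (⊤ : Subgroup G)) (invariantSubring R H) R :=
  .of_algebraMap_eq fun _ => rfl

instance (H : Subgroup G) : Algebra.IsInvariant (invariantSubring R H) R H :=
  ⟨fun r hr => ⟨⟨r, fun h hh => hr ⟨h, hh⟩⟩, rfl⟩⟩

instance (H : Subgroup G) : SMulCommClass H (invariantSubring R H) R :=
  ⟨fun h a r => by
    simp only [Subgroup.smul_def, Subring.smul_def, smul_eq_mul, smul_mul', a.2 h h.2]⟩

variable [Finite G]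

instance hasGoingDown_invariantSubring (H : Subgroup G) :
    Algebra.HasGoingDown (invariantSubring R (⊤ : Subgroup G)) (invariantSubring R H) :=
  have := Algebra.IsInvariant.isIntegral (invariantSubring R H) R H
  have := Algebra.IsInvariant.hasGoingDown (invariantSubring R (⊤ : Subgroup G)) R
    (⊤ : Subgroup G)
  .of_isIntegral_top (C := R)

theorem relTrace_algebraMap_mul (H : Subgroup G) (a : invariantSubring R (⊤ : Subgroup G))
    (r : invariantSubring R H) : relTrace H (algebraMap _ _ a * r) = a * relTrace H r := by
  refine Subtype.ext ?_
  simp only [relTrace, AddMonoidHom.coe_mk, ZeroHom.coe_mk, Subring.coe_mul, Finset.mul_sum]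
  refine Finset.sum_congr rfl fun x _ => ?_
  induction x using QuotientGroup.induction_on with
  | H g =>
    simp only [cosetSMul_mk, Subring.coe_mul, smul_mul']
    exact congrArg (· * _) (a.2 g trivial)

/-- The `R^G`-linear map `R^H → R^G`, `b ↦ tr_{G/H}(b r)`. -/
noncomputable def relTraceMul (H : Subgroup G) (r : invariantSubring R H) :
    invariantSubring R H →ₗ[invariantSubring R (⊤ : Subgroup G)]
      invariantSubring R (⊤ : Subgroup G) where
  toFun b := relTrace H (b * r)
  map_add' b c := by rw [add_mul, map_add]
  map_smul' a b := by
    rw [Algebra.smul_def, mul_assoc, relTrace_algebraMap_mul, RingHom.id_apply, smul_eq_mul]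

theorem relTrace_one (H : Subgroup G) : relTrace H (1 : invariantSubring R H) = H.index := by
  refine Subtype.ext ?_
  have h (x : G ⧸ H) : cosetSMul H (1 : invariantSubring R H) x = 1 := by
    induction x using QuotientGroup.induction_on with
    | H g => exact smul_one g
  simp [relTrace, h, Subgroup.index, ← Nat.card_eq_fintype_card]

theorem exists_sum_relTrace_eq_of_mem_traceIdealOf (𝒳 : Set (Subgroup G)) [Fintype 𝒳]
    {u : invariantSubring R (⊤ : Subgroup G)} (hu : u ∈ traceIdealOf R 𝒳) :
    ∃ r : ∀ H : 𝒳, invariantSubring R H.1, ∑ H, relTrace H.1 (r H) = u := by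
  classical
  rw [traceIdealOf, iSup_subtype'] at hu
  induction hu using Submodule.iSup_induction' with
  | mem H x hx =>
    obtain ⟨r, rfl⟩ := hx
    refine ⟨Pi.single H r, ?_⟩
    rw [Finset.sum_eq_single H (fun K _ hK => by rw [Pi.single_eq_of_ne hK, map_zero])
      (by simp), Pi.single_eq_same]
  | zero => exact ⟨0, by simp⟩
  | add x y _ _ hx hy =>
    obtain ⟨r, rfl⟩ := hx
    obtain ⟨s, rfl⟩ := hy
    exact ⟨r + s, by simp [Finset.sum_add_distrib]⟩

/-- If the trace ideal of `𝒳` meets `S`, then the Cohen-Macaulay property descends from the `R^H`,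
`H ∈ 𝒳`, to the localization of `R^G` at `S`. -/
theorem isCohenMacaulayRing_localization_of_mem_traceIdealOf (𝒳 : Set (Subgroup G))
    (h𝒳 : ∀ H ∈ 𝒳, IsCohenMacaulayRing (invariantSubring R H))
    (S : Submonoid (invariantSubring R (⊤ : Subgroup G)))
    {u : invariantSubring R (⊤ : Subgroup G)} (hu : u ∈ traceIdealOf R 𝒳) (huS : u ∈ S)
    (A' : Type*) [CommRing A'] [Algebra (invariantSubring R (⊤ : Subgroup G)) A']
    [IsLocalization S A'] : IsCohenMacaulayRing A' := by
  have := Fintype.ofFinite 𝒳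
  obtain ⟨r, rfl⟩ := exists_sum_relTrace_eq_of_mem_traceIdealOf 𝒳 hu
  refine isCohenMacaulayRing_localization_of_sum_apply_one_mem
    (fun H : 𝒳 => relTraceMul H.1 (r H)) S ?_ A' fun H => h𝒳 H H.2
  simpa [relTraceMul] using huS

end InvariantSubrings

theorem mainTheorem8 {G : Type*} [Group G] [Finite G] {R : Type*} [CommRing R]
    [MulSemiringAction G R] :
    (∀ (𝔮 : Ideal (invariantSubring R (⊤ : Subgroup G))) [𝔮.IsPrime],
      ¬ traceIdealOf R (cohenMacaulaySubgroups G R) ≤ 𝔮 →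
        IsCohenMacaulayRing (Localization.AtPrime 𝔮)) ∧
    (∀ 𝒳 : Set (Subgroup G),
      (∀ H ∈ 𝒳, IsCohenMacaulayRing (invariantSubring R H)) →
      Ideal.span ((fun H : Subgroup G =>
        (H.index : invariantSubring R (⊤ : Subgroup G))) '' 𝒳) = ⊤ →
      IsCohenMacaulayRing (invariantSubring R (⊤ : Subgroup G))) := by
  refine ⟨fun 𝔮 _ h𝔮 => ?_, fun 𝒳 h𝒳 hspan => ?_⟩
  · obtain ⟨u, hu, hu𝔮⟩ := SetLike.not_le_iff_exists.mp h𝔮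
    exact isCohenMacaulayRing_localization_of_mem_traceIdealOf (cohenMacaulaySubgroups G R)
      (fun _ hH => hH) 𝔮.primeCompl hu hu𝔮 _
  · have hle : Ideal.span ((fun H : Subgroup G =>
        (H.index : invariantSubring R (⊤ : Subgroup G))) '' 𝒳) ≤ traceIdealOf R 𝒳 := by
      rw [Ideal.span_le]
      rintro _ ⟨H, hH, rfl⟩
      exact (le_iSup₂ (f := fun H (_ : H ∈ 𝒳) => relTraceIdeal (R := R) H) H hH)
        ⟨1, relTrace_one H⟩
    have : IsLocalization (⊥ : Submonoid (invariantSubring R (⊤ : Subgroup G)))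
        (invariantSubring R (⊤ : Subgroup G)) := IsLocalization.self bot_le
    exact isCohenMacaulayRing_localization_of_mem_traceIdealOf 𝒳 h𝒳 ⊥
      (hle (hspan ▸ Submodule.mem_top)) (Submonoid.one_mem _) _
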